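/- Let $\mathcal M$ be a von Neumann algebra with a normal faithful tracial state $\tau$, with $\|x\|_2=\tau(x^*x)^{1/2}$. Let $(\mathcal A_n)_{n\ge1}$ be von Neumann subalgebras of $\mathcal M$ that are order independent with respect to $\tau$, that is, $\tau(xy)=\tau(x)\tau(y)$ for every $n\ge1$, every $x\in\mathcal A_n$ and every $y$ in the von Neumann algebra generated by $\mathcal A_1,\dots,\mathcal A_{n-1}$. Let $a_n\in\mathcal A_n$ satisfy $\tau(a_n)=0$ for all $n\ge1$, and $$\inf_{n\ge1}\|a_n\|_2=\alpha>0,\qquad \sup_{n\ge1}\|a_n\|_\infty=\beta<\infty .$$ Let $\mathcal B$ be a von Neumann algebra with a normal faithful tracial state $\nu$. Let $\mathcal M_n$ be the von Neumann algebra generated by $\mathcal A_1,\dots,\mathcal A_n$, and let $\mathcal E_n$ be the $(\tau\otimes\nu)$-preserving normal conditional expectation of $\mathcal M\bar\otimes\mathcal B$ onto $\mathcal M_n\bar\otimes\mathcal B$ for $n\ge1$, with the convention $\mathcal E_0=0$. For $x\in\mathcal M\bar\otimes\mathcal B$ put $$\|x\|_{\mathrm{BMO}_C}=\Big(\sup_{n\ge1}\big\|\mathcal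 E_n|x-\mathcal E_{n-1}x|^2\big\|_\infty\Big)^{1/2},\qquad \|x\|_{\mathrm{BMO}}=\max\{\|x\|_{\mathrm{BMO}_C},\|x^*\|_{\mathrm{BMO}_C}\}.$$ Then there is a constant $C>0$, depending only on $\alpha$ and $\beta$, such that for every finite sequence $b=(b_n)_{n\ge1}$ in $\mathcal B$, $$C^{-1}\,\|b\|\;\le\;\Big\|\sum_{n\ge1}a_n\otimes b_n\Big\|_{\mathrm{BMO}(\mathcal M\bar\otimes\mathcal B)}\;\le\;C\,\|b\|,$$ where $\|b\|$ is the norm of $b$ in $L^\infty(\mathcal B;l^2_C)\cap L^\infty(\mathcal B;l^2_R)$, namely $$\|b\|=\max\Big\{\Big\|\Big(\sum_{n\ge1}b_n^*b_n\Big)^{1/2}\Big\|_\infty,\ \Big\|\Big(\sum_{n\ge1}b_nb_n^*\Big)^{1/2}\Big\|_\infty\Big\}.$$ -/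

import Mathlib

open scoped TensorProduct

set_option linter.unusedSectionVars false

noncomputable section

namespace NCBMO

universe u v

variable {H : Type u} [NormedAddCommGroup H] [InnerProductSpace ℂ H] [CompleteSpace H]
variable {K : Type v} [NormedAddCommGroup K] [InnerProductSpace ℂ K] [CompleteSpace K]

/-! ### Von Neumann algebras: generation and tensor products -/

/-- The von Neumann algebra generated by a set `S` of bounded operators: the double commutant of
`S ∪ S*`. -/
def generated (S : Set (H →L[ℂ] H)) : VonNeumannAlgebra H where
  toStarSubalgebra :=
    StarSubalgebra.centralizer ℂ (StarSubalgebra.centralizer ℂ S : Set (H →L[ℂ] H))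
  centralizer_centralizer' := by
    have h : ((StarSubalgebra.centralizer ℂ
        (StarSubalgebra.centralizer ℂ S : Set (H →L[ℂ] H)) : StarSubalgebra ℂ (H →L[ℂ] H)) :
          Set (H →L[ℂ] H)) =
        Set.centralizer (StarSubalgebra.centralizer ℂ S : Set (H →L[ℂ] H)) := by
      rw [StarSubalgebra.coe_centralizer]
      congr 1
      exact Set.union_eq_self_of_subset_right fun x hx => star_star x ▸ star_mem hx
    change Set.centralizer (Set.centralizer (((StarSubalgebra.centralizer ℂ
        (StarSubalgebra.centralizer ℂ S : Set (H →L[ℂ] H)) : StarSubalgebra ℂ (H →L[ℂ] H)) :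
          Set (H →L[ℂ] H)))) = ((StarSubalgebra.centralizer ℂ
        (StarSubalgebra.centralizer ℂ S : Set (H →L[ℂ] H)) : StarSubalgebra ℂ (H →L[ℂ] H)) :
          Set (H →L[ℂ] H))
    rw [h, Set.centralizer_centralizer_centralizer]

/-- A generated von Neumann algebra contains its generators. -/
theorem subset_generated (S : Set (H →L[ℂ] H)) : S ⊆ (generated S : Set (H →L[ℂ] H)) := by
  intro x hx
  change x ∈ StarSubalgebra.centralizer ℂ (StarSubalgebra.centralizer ℂ S : Set (H →L[ℂ] H))
  rw [StarSubalgebra.mem_centralizer_iff]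
  intro g hg
  exact ⟨((StarSubalgebra.mem_centralizer_iff ℂ).1 hg x hx).1.symm,
    ((StarSubalgebra.mem_centralizer_iff ℂ).1 (star_mem hg) x hx).1.symm⟩

/-- A von Neumann algebra that contains the generators contains the generated algebra. -/
theorem generated_le {S : Set (H →L[ℂ] H)} {N : VonNeumannAlgebra H}
    (h : S ⊆ (N : Set (H →L[ℂ] H))) : generated S ≤ N := by
  intro x hx
  have hx' : x ∈ StarSubalgebra.centralizer ℂ
      (StarSubalgebra.centralizer ℂ S : Set (H →L[ℂ] H)) := hx
  rw [StarSubalgebra.mem_centralizer_iff] at hx'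
  rw [← SetLike.mem_coe, ← N.centralizer_centralizer, Set.mem_centralizer_iff]
  intro g hg
  refine (hx' g ?_).1
  rw [SetLike.mem_coe, StarSubalgebra.mem_centralizer_iff]
  exact fun s hs => ⟨hg s (h hs), hg (star s) (star_mem (S := VonNeumannAlgebra H) (h hs))⟩

variable (H K) in
/-- The Hilbert space tensor product of `H` and `K`. -/
abbrev HilbertTensor : Type (max u v) := UniformSpace.Completion (H ⊗[ℂ] K)

/-- The elementary tensor `ξ ⊗ η` of two vectors, in the Hilbert space tensor product. -/
def vecTensor (ξ : H) (η : K) : HilbertTensor H K := ((ξ ⊗ₜ[ℂ] η : H ⊗[ℂ] K) : HilbertTensor H K)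

/-- The tensor product `a ⊗ b` of two bounded operators, a bounded operator on the Hilbert space
tensor product. -/
def opTensor (a : H →L[ℂ] H) (b : K →L[ℂ] K) : HilbertTensor H K →L[ℂ] HilbertTensor H K :=
  (TensorProduct.mapL a b).completion

theorem opTensor_vecTensor (a : H →L[ℂ] H) (b : K →L[ℂ] K) (ξ : H) (η : K) :
    opTensor a b (vecTensor ξ η) = vecTensor (a ξ) (b η) := by
  simp [opTensor, vecTensor]

theorem inner_vecTensor (ξ ξ' : H) (η η' : K) :
    inner ℂ (vecTensor ξ η) (vecTensor ξ' η') = inner ℂ ξ ξ' * inner ℂ η η' := by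
  simp [vecTensor, UniformSpace.Completion.inner_coe]

/-- The von Neumann algebra tensor product of `M` and `B`: the von Neumann algebra on the Hilbert
space tensor product generated by the operators `a ⊗ b`, `a ∈ M`, `b ∈ B`. -/
def vnTensor (M : VonNeumannAlgebra H) (B : VonNeumannAlgebra K) :
    VonNeumannAlgebra (HilbertTensor H K) :=
  generated {x | ∃ a ∈ M, ∃ b ∈ B, x = opTensor a b}

/-! ### Traces -/

/-- A normal faithful tracial state on a von Neumann algebra `M`. Normality together with
positivity is expressed by the usual description of normal positive functionals on a concrete von
Neumann algebra, as the countable sums `x ↦ ∑ ⟨ξᵢ, x ξᵢ⟩` of vector functionals with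
`∑ ‖ξᵢ‖² < ∞`. -/
structure TracialState (M : VonNeumannAlgebra H) where
  /-- the underlying linear functional -/
  toLinearMap : M.toStarSubalgebra →ₗ[ℂ] ℂ
  normal' : ∃ ξ : ℕ → H, Summable (fun i => ‖ξ i‖ ^ 2) ∧
    ∀ x : M.toStarSubalgebra,
      HasSum (fun i => inner ℂ (ξ i) ((x : H →L[ℂ] H) (ξ i))) (toLinearMap x)
  map_one' : toLinearMap 1 = 1
  tracial' : ∀ x y : M.toStarSubalgebra, toLinearMap (x * y) = toLinearMap (y * x)
  faithful' : ∀ x : M.toStarSubalgebra, toLinearMap (star x * x) = 0 → x = 0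

instance (M : VonNeumannAlgebra H) :
    CoeFun (TracialState M) (fun _ => M.toStarSubalgebra → ℂ) :=
  ⟨fun τ => τ.toLinearMap⟩

/-- The norm of the noncommutative `L²` space: `‖x‖₂ = τ(|x|²)^{1/2}`, for `x ∈ M`. -/
def TracialState.norm2 {M : VonNeumannAlgebra H} (τ : TracialState M)
    (x : M.toStarSubalgebra) : ℝ :=
  Real.sqrt (τ (star x * x)).re

/-- Vectors `ξᵢ` such that `τ x = ∑ ⟨ξᵢ, x ξᵢ⟩`. -/
def TracialState.vectors {M : VonNeumannAlgebra H} (τ : TracialState M) : ℕ → H :=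
  τ.normal'.choose

/-- The product trace `τ ⊗ ν`, as the sum of vector functionals
`x ↦ ∑ ⟨ξᵢ ⊗ ηⱼ, x (ξᵢ ⊗ ηⱼ)⟩`, where `τ = ∑ ⟨ξᵢ, · ξᵢ⟩` and `ν = ∑ ⟨ηⱼ, · ηⱼ⟩`. On the von
Neumann algebra tensor product it is the unique normal functional that takes the value
`τ a * ν b` at `a ⊗ b`. -/
def tensorTrace {M : VonNeumannAlgebra H} {B : VonNeumannAlgebra K} (τ : TracialState M)
    (ν : TracialState B) (x : HilbertTensor H K →L[ℂ] HilbertTensor H K) : ℂ :=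
  ∑' p : ℕ × ℕ, inner ℂ (vecTensor (τ.vectors p.1) (ν.vectors p.2))
    (x (vecTensor (τ.vectors p.1) (ν.vectors p.2)))

theorem summable_norm_inner (T : H →L[ℂ] H) {ξ : ℕ → H}
    (hξ : Summable (fun i => ‖ξ i‖ ^ 2)) :
    Summable (fun i => ‖(inner ℂ (ξ i) (T (ξ i)) : ℂ)‖) := by
  refine Summable.of_nonneg_of_le (fun _ => norm_nonneg _) (fun i => ?_) (hξ.mul_left ‖T‖)
  calc ‖(inner ℂ (ξ i) (T (ξ i)) : ℂ)‖ ≤ ‖ξ i‖ * ‖T (ξ i)‖ := norm_inner_le_norm _ _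
    _ ≤ ‖ξ i‖ * (‖T‖ * ‖ξ i‖) := by gcongr; exact T.le_opNorm _
    _ = ‖T‖ * ‖ξ i‖ ^ 2 := by ring

/-- The product trace takes the value `τ a * ν b` at `a ⊗ b`. -/
theorem tensorTrace_opTensor {M : VonNeumannAlgebra H} {B : VonNeumannAlgebra K}
    (τ : TracialState M) (ν : TracialState B) (a : M.toStarSubalgebra)
    (b : B.toStarSubalgebra) :
    tensorTrace τ ν (opTensor (a : H →L[ℂ] H) (b : K →L[ℂ] K)) = τ a * ν b := by
  have h1 : Summable (fun i => ‖τ.vectors i‖ ^ 2) := τ.normal'.choose_spec.1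
  have h2 : HasSum (fun i => inner ℂ (τ.vectors i) ((a : H →L[ℂ] H) (τ.vectors i))) (τ a) :=
    τ.normal'.choose_spec.2 a
  have k1 : Summable (fun i => ‖ν.vectors i‖ ^ 2) := ν.normal'.choose_spec.1
  have k2 : HasSum (fun i => inner ℂ (ν.vectors i) ((b : K →L[ℂ] K) (ν.vectors i))) (ν b) :=
    ν.normal'.choose_spec.2 b
  have e := tsum_mul_tsum_of_summable_norm
    (summable_norm_inner (a : H →L[ℂ] H) h1) (summable_norm_inner (b : K →L[ℂ] K) k1)
  rw [h2.tsum_eq, k2.tsum_eq] at e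
  rw [e, tensorTrace]
  refine tsum_congr fun p => ?_
  rw [opTensor_vecTensor, inner_vecTensor]

/-! ### Conditional expectations and the martingale BMO norm -/

/-- `y` is the conditional expectation of the bounded operator `x` onto the von Neumann algebra
`N`, with respect to the trace `φ`: `y` lies in `N`, and `φ (y z) = φ (x z)` for all `z ∈ N`.
If `φ` is a normal faithful finite trace on a von Neumann algebra that contains `x` and `N`, there
is exactly one such `y`, and `x ↦ y` is the unique normal conditional expectation onto `N` that
preserves `φ`. -/
def IsCondExp (φ : (H →L[ℂ] H) → ℂ) (N : VonNeumannAlgebra H) (x y : H →L[ℂ] H) : Prop :=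
  y ∈ N ∧ ∀ z ∈ N, φ (y * z) = φ (x * z)

open Classical in
/-- The conditional expectation of `x` onto `N` that preserves the trace `φ`. -/
def condExp (φ : (H →L[ℂ] H) → ℂ) (N : VonNeumannAlgebra H) (x : H →L[ℂ] H) : H →L[ℂ] H :=
  if h : ∃ y, IsCondExp φ N x y then h.choose else 0

/-- The conditional expectation that precedes the one onto `N n`: zero for the first algebra
`N 0` of the filtration (a martingale starts from `x₀ = 0`), and the one onto `N (n - 1)`
afterwards. -/
def condExpPrev (φ : (H →L[ℂ] H) → ℂ) (N : ℕ → VonNeumannAlgebra H) :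
    ℕ → (H →L[ℂ] H) → (H →L[ℂ] H)
  | 0, _ => 0
  | n + 1, x => condExp φ (N n) x

/-- The column BMO norm, on bounded operators, for the trace `φ` and the filtration
`N 0 ≤ N 1 ≤ ⋯`: the square root of the supremum over `n` of the operator norms of
`𝓔ₙ |x - 𝓔ₙ₋₁ x|²`. -/
def bmoC (φ : (H →L[ℂ] H) → ℂ) (N : ℕ → VonNeumannAlgebra H) (x : H →L[ℂ] H) : ENNReal :=
  (⨆ n : ℕ, ‖condExp φ (N n)
    (star (x - condExpPrev φ N n x) * (x - condExpPrev φ N n x))‖ₑ) ^ (1 / 2 : ℝ)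

/-- The BMO norm: the maximum of the column BMO norms of `x` and `x*`. -/
def bmo (φ : (H →L[ℂ] H) → ℂ) (N : ℕ → VonNeumannAlgebra H) (x : H →L[ℂ] H) : ENNReal :=
  max (bmoC φ N x) (bmoC φ N (star x))

/-! ### Independence -/

/-- Order independence with respect to the trace: `τ (x y) = τ x * τ y` whenever `x ∈ A n` and `y`
lies in the von Neumann algebra generated by the `A k` with `k < n`. -/
def OrderIndependent {M : VonNeumannAlgebra H} (τ : TracialState M)
    (A : ℕ → VonNeumannAlgebra H) : Prop :=
  ∀ n : ℕ, ∀ x y : M.toStarSubalgebra, (x : H →L[ℂ] H) ∈ A n →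
    (y : H →L[ℂ] H) ∈ generated (⋃ k < n, (A k : Set (H →L[ℂ] H))) → τ (x * y) = τ x * τ y

/-- The filtration of the von Neumann algebras generated by `A 0, …, A n`. -/
def filtration (A : ℕ → VonNeumannAlgebra H) (n : ℕ) : VonNeumannAlgebra H :=
  generated (⋃ k ≤ n, (A k : Set (H →L[ℂ] H)))

/-! ### Square functions -/

/-- The norm of the finite sequence `b 0, …, b (m - 1)` in `L^∞(l²_C)`, that is the operator norm of
`(∑ |bₙ|²)^{1/2}`. -/
def squareNormC (m : ℕ) (b : ℕ → K →L[ℂ] K) : ℝ :=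
  ‖CFC.sqrt (∑ n ∈ Finset.range m, star (b n) * b n)‖

/-- The norm in `L^∞(l²_R)`, that is the operator norm of `(∑ |bₙ*|²)^{1/2}`. -/
def squareNormR (m : ℕ) (b : ℕ → K →L[ℂ] K) : ℝ :=
  ‖CFC.sqrt (∑ n ∈ Finset.range m, b n * star (b n))‖

/-- The norm in the intersection of `L^∞(l²_C)` and `L^∞(l²_R)`: the maximum of the two norms. -/
def squareNorm (m : ℕ) (b : ℕ → K →L[ℂ] K) : ℝ :=
  max (squareNormC m b) (squareNormR m b)

end NCBMO

end

/-!
The upper and lower estimates rest on an exact formula. Write `x = ∑ aₖ ⊗ bₖ`, and number the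
algebras from `0`. Since `aₖ` is centred and independent of the algebras before it, `𝓔ₙ₋₁` keeps the
terms `k < n` of `x` and kills the others, so `x - 𝓔ₙ₋₁ x = ∑_{k ≥ n} aₖ ⊗ bₖ`. In the
conditional square of this tail the off-diagonal terms vanish by independence and traciality, and
`𝓔ₙ |x - 𝓔ₙ₋₁ x|² = |aₙ|² ⊗ |bₙ|² + ∑_{k > n} ‖aₖ‖₂² (1 ⊗ |bₖ|²)`
(`condExpPrev_sum`, `condExp_star_mul_tail`). Every coefficient is at most `β²`, which gives the
upper bound (`norm_sum_condExpSq_le`). For the lower bound it is enough to look at `n = 0`: the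
first term has norm at least `α² ‖b₀‖²`, and the rest dominates `α² (1 ⊗ ∑_{k > 0} |bₖ|²)`
(`norm_sum_le_norm_sum_condExpSq`). The row estimate is the column estimate for the adjoints.

Computing with `condExp` requires existence and uniqueness of conditional expectations.

* Uniqueness is faithfulness of the product trace on the tensor product
  (`eq_zero_of_tensorTrace_mul_star`): the vectors that define `τ` and `ν` are separating, hence
  cyclic for the commutants, and the tensors of the commutants commute with the tensor product.
* Existence is needed only for sums of elementary tensors, where the candidate is explicit. That it
  may be tested against elementary tensors alone (`isCondExp_opTensor`) follows from density
  for normal functionals (`tsum_inner_eq_zero_of_mem_generated`), which is proved by von Neumann's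
  argument in the amplification to `ℓ²`.
-/

noncomputable section

namespace NCBMO

universe u v

variable {H : Type u} [NormedAddCommGroup H] [InnerProductSpace ℂ H] [CompleteSpace H]
variable {K : Type v} [NormedAddCommGroup K] [InnerProductSpace ℂ K] [CompleteSpace K]

/-! ### Density for normal functionals -/

section Density

variable {ι : Type*}

theorem summable_norm_sq_apply (T : H →L[ℂ] H) {ζ : ι → H} (hζ : Summable fun i => ‖ζ i‖ ^ 2) :
    Summable fun i => ‖T (ζ i)‖ ^ 2 := by
  refine Summable.of_nonneg_of_le (fun _ => by positivity) (fun i => ?_) (hζ.mul_left (‖T‖ ^ 2))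
  rw [← mul_pow]
  gcongr
  exact T.le_opNorm _

theorem memℓp_two_iff {ζ : ι → H} : Memℓp ζ 2 ↔ Summable fun i => ‖ζ i‖ ^ 2 := by
  rw [memℓp_gen_iff (by norm_num)]
  norm_num

theorem lp_two_norm_sq (f : lp (fun _ : ι => H) 2) : ‖f‖ ^ 2 = ∑' i, ‖f i‖ ^ 2 := by
  have h := lp.norm_rpow_eq_tsum (p := 2) (by norm_num) f
  norm_num at h
  exact h

/-- The diagonal amplification `T ⊗ 1` of an operator on `H` to `ℓ²(ι; H)`. -/
def amplify (ι : Type*) (T : H →L[ℂ] H) :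
    lp (fun _ : ι => H) 2 →L[ℂ] lp (fun _ : ι => H) 2 :=
  LinearMap.mkContinuous
    { toFun := fun f => ⟨fun i => T (f i),
        memℓp_two_iff.2 (summable_norm_sq_apply T (memℓp_two_iff.1 f.2))⟩
      map_add' := fun f g => by ext i; exact map_add T (f i) (g i)
      map_smul' := fun c f => by ext i; exact map_smul T c (f i) } ‖T‖ fun f => by
    refine le_of_sq_le_sq ?_ (by positivity)
    have hf := memℓp_two_iff.1 f.2
    rw [mul_pow, lp_two_norm_sq, lp_two_norm_sq, ← tsum_mul_left]
    refine (summable_norm_sq_apply T hf).tsum_le_tsum (fun i => ?_) (hf.mul_left _)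
    rw [← mul_pow]
    gcongr
    exact T.le_opNorm _

@[simp]
theorem amplify_apply (T : H →L[ℂ] H) (f : lp (fun _ : ι => H) 2) (i : ι) :
    amplify ι T f i = T (f i) := rfl

theorem inner_amplify_left (T : H →L[ℂ] H) (f g : lp (fun _ : ι => H) 2) :
    inner ℂ (amplify ι T f) g = inner ℂ f (amplify ι (star T) g) := by
  rw [lp.inner_eq_tsum, lp.inner_eq_tsum]
  refine tsum_congr fun i => ?_
  rw [amplify_apply, amplify_apply, ContinuousLinearMap.star_eq_adjoint,
    ContinuousLinearMap.adjoint_inner_right]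

/-- The closed subspace of `ℓ²(ι; H)` spanned by the orbit of `ζ` under the amplifications of the
operators in `S`. -/
def orbitClosure (S : Set (H →L[ℂ] H)) (ζ : lp (fun _ : ι => H) 2) :
    Submodule ℂ (lp (fun _ : ι => H) 2) :=
  (Submodule.span ℂ ((fun s => amplify ι s ζ) '' S)).topologicalClosure

theorem amplify_mem_orbitClosure {S : Set (H →L[ℂ] H)} (ζ : lp (fun _ : ι => H) 2)
    {s : H →L[ℂ] H} (hs : s ∈ S) : amplify ι s ζ ∈ orbitClosure S ζ :=
  Submodule.le_topologicalClosure _ (Submodule.subset_span ⟨s, hs, rfl⟩)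

theorem amplify_mem_orbitClosure_of_mem {S : Set (H →L[ℂ] H)}
    (hmul : ∀ s ∈ S, ∀ t ∈ S, s * t ∈ S) {ζ f : lp (fun _ : ι => H) 2} {s : H →L[ℂ] H}
    (hs : s ∈ S) (hf : f ∈ orbitClosure S ζ) : amplify ι s f ∈ orbitClosure S ζ := by
  have h : orbitClosure S ζ ≤ (orbitClosure S ζ).comap (amplify ι s).toLinearMap := by
    refine Submodule.topologicalClosure_minimal _ (Submodule.span_le.2 ?_) ?_
    · rintro _ ⟨t, ht, rfl⟩
      exact amplify_mem_orbitClosure ζ (hmul s hs t ht)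
    · exact (Submodule.isClosed_topologicalClosure _).preimage (amplify ι s).continuous
  exact h hf

/-- The double commutant theorem, in the amplified form that describes the `σ`-strong closure: for
a multiplicative self-adjoint set `S` containing `1`, every operator in the von Neumann algebra
generated by `S` maps a square summable family into the closed span of the images under `S`. -/
theorem amplify_mem_orbitClosure_of_mem_generated {S : Set (H →L[ℂ] H)}
    (hmul : ∀ s ∈ S, ∀ t ∈ S, s * t ∈ S) (hstar : ∀ s ∈ S, star s ∈ S) (h1 : 1 ∈ S)
    (ζ : lp (fun _ : ι => H) 2) {z : H →L[ℂ] H} (hz : z ∈ generated S) :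
    amplify ι z ζ ∈ orbitClosure S ζ := by
  classical
  set V := orbitClosure S ζ
  have : CompleteSpace V := (Submodule.isClosed_topologicalClosure _).completeSpace_coe
  have hζ : ζ ∈ V := amplify_mem_orbitClosure ζ h1
  set P := V.starProjection
  have hcomm : ∀ s ∈ S, ∀ f, P (amplify ι s f) = amplify ι s (P f) := by
    intro s hs f
    refine Submodule.eq_starProjection_of_mem_orthogonal
      (amplify_mem_orbitClosure_of_mem hmul hs (V.starProjection_apply_mem f)) ?_
    rw [← map_sub, Submodule.mem_orthogonal]
    intro g hg
    rw [← star_star s, ← inner_amplify_left]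
    exact (Submodule.mem_orthogonal _ _).1 (V.sub_starProjection_mem_orthogonal f) _
      (amplify_mem_orbitClosure_of_mem hmul (hstar s hs) hg)
  have hsingle : ∀ (T : H →L[ℂ] H) (j : ι) (v : H),
      amplify ι T (lp.single 2 j v) = lp.single 2 j (T v) := by
    intro T j v
    ext i
    by_cases hij : i = j
    · subst hij; simp
    · simp [hij]
  -- The matrix entries of `P` with respect to `ℓ²(ι; H)` commute with `S`, hence with `z`.
  have hentry : ∀ i j : ι, ∀ v : H, P (lp.single 2 j (z v)) i = z (P (lp.single 2 j v) i) := by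
    intro i j v
    set Q : H →L[ℂ] H := lp.evalCLM ℂ (fun _ : ι => H) 2 i ∘L P ∘L
      lp.singleContinuousLinearMap ℂ (fun _ : ι => H) 2 j
    have hQS : ∀ s ∈ S, s * Q = Q * s := by
      intro s hs
      ext w
      change s (P (lp.single 2 j w) i) = P (lp.single 2 j (s w)) i
      rw [← hsingle, hcomm s hs, amplify_apply]
    have hQc : Q ∈ StarSubalgebra.centralizer ℂ S :=
      (StarSubalgebra.mem_centralizer_iff ℂ).2 fun s hs => ⟨hQS s hs, hQS _ (hstar s hs)⟩
    exact congrArg (fun T : H →L[ℂ] H => T v)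
      ((StarSubalgebra.mem_centralizer_iff ℂ).1 hz Q hQc).1
  have hP : P (amplify ι z ζ) = amplify ι z (P ζ) := by
    have e := lp.hasSum_single (p := 2) (by norm_num) ζ
    have e1 := (e.mapL (amplify ι z)).mapL P
    have e2 := (e.mapL P).mapL (amplify ι z)
    refine e1.unique ?_
    convert e2 using 2 with j
    ext i
    rw [hsingle, amplify_apply, hentry]
  rw [V.starProjection_eq_self_iff.2 hζ] at hP
  exact V.starProjection_eq_self_iff.1 hP

/-- A normal functional that vanishes on a multiplicative self-adjoint set `S` containing `1`
vanishes on the von Neumann algebra generated by `S`. -/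
theorem tsum_inner_eq_zero_of_mem_generated {S : Set (H →L[ℂ] H)}
    (hmul : ∀ s ∈ S, ∀ t ∈ S, s * t ∈ S) (hstar : ∀ s ∈ S, star s ∈ S) (h1 : 1 ∈ S)
    {θ ζ : ι → H} (hθ : Summable fun i => ‖θ i‖ ^ 2) (hζ : Summable fun i => ‖ζ i‖ ^ 2)
    (h : ∀ s ∈ S, ∑' i, inner ℂ (θ i) (s (ζ i)) = 0) {z : H →L[ℂ] H} (hz : z ∈ generated S) :
    ∑' i, inner ℂ (θ i) (z (ζ i)) = 0 := by
  let θ' : lp (fun _ : ι => H) 2 := ⟨θ, memℓp_two_iff.2 hθ⟩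
  let ζ' : lp (fun _ : ι => H) 2 := ⟨ζ, memℓp_two_iff.2 hζ⟩
  have hle : orbitClosure S ζ' ≤ (ℂ ∙ θ')ᗮ := by
    refine Submodule.topologicalClosure_minimal _ (Submodule.span_le.2 ?_)
      (Submodule.isClosed_orthogonal _)
    rintro _ ⟨s, hs, rfl⟩
    rw [SetLike.mem_coe, Submodule.mem_orthogonal_singleton_iff_inner_right, lp.inner_eq_tsum]
    exact h s hs
  have hz' := hle (amplify_mem_orbitClosure_of_mem_generated hmul hstar h1 ζ' hz)
  rw [Submodule.mem_orthogonal_singleton_iff_inner_right, lp.inner_eq_tsum] at hz'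
  exact hz'

end Density

/-! ### Tensor products of operators -/

theorem norm_vecTensor (ξ : H) (η : K) : ‖vecTensor ξ η‖ = ‖ξ‖ * ‖η‖ := by
  simp [vecTensor]

theorem hilbertTensor_ext {E : Type*} [NormedAddCommGroup E] [NormedSpace ℂ E]
    {S T : HilbertTensor H K →L[ℂ] E} (h : ∀ ξ η, S (vecTensor ξ η) = T (vecTensor ξ η)) :
    S = T := by
  ext x
  induction x using UniformSpace.Completion.induction_on with
  | hp => exact isClosed_eq S.continuous T.continuous
  | ih x =>
    induction x with
    | zero => rw [UniformSpace.Completion.coe_zero, map_zero, map_zero]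
    | tmul ξ η => exact h ξ η
    | add x y hx hy => rw [UniformSpace.Completion.coe_add, map_add, map_add, hx, hy]

theorem opTensor_mul (a a' : H →L[ℂ] H) (b b' : K →L[ℂ] K) :
    opTensor a b * opTensor a' b' = opTensor (a * a') (b * b') :=
  hilbertTensor_ext fun ξ η => by simp [opTensor_vecTensor]

theorem opTensor_one : opTensor (1 : H →L[ℂ] H) (1 : K →L[ℂ] K) = 1 :=
  hilbertTensor_ext fun ξ η => by simp [opTensor_vecTensor]

theorem vecTensor_add_left (ξ ξ' : H) (η : K) :
    vecTensor (ξ + ξ') η = vecTensor ξ η + vecTensor ξ' η := by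
  rw [vecTensor, TensorProduct.add_tmul, UniformSpace.Completion.coe_add]; rfl

theorem vecTensor_add_right (ξ : H) (η η' : K) :
    vecTensor ξ (η + η') = vecTensor ξ η + vecTensor ξ η' := by
  rw [vecTensor, TensorProduct.tmul_add, UniformSpace.Completion.coe_add]; rfl

theorem vecTensor_smul_left (c : ℂ) (ξ : H) (η : K) :
    vecTensor (c • ξ) η = c • vecTensor ξ η := by
  rw [vecTensor, ← TensorProduct.smul_tmul', UniformSpace.Completion.coe_smul]; rfl

theorem vecTensor_smul_right (c : ℂ) (ξ : H) (η : K) :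
    vecTensor ξ (c • η) = c • vecTensor ξ η := by
  rw [vecTensor, TensorProduct.tmul_smul, UniformSpace.Completion.coe_smul]; rfl

theorem opTensor_smul_left (c : ℂ) (a : H →L[ℂ] H) (b : K →L[ℂ] K) :
    opTensor (c • a) b = c • opTensor a b :=
  hilbertTensor_ext fun ξ η => by simp [opTensor_vecTensor, vecTensor_smul_left]

theorem opTensor_add_right (a : H →L[ℂ] H) (b b' : K →L[ℂ] K) :
    opTensor a (b + b') = opTensor a b + opTensor a b' :=
  hilbertTensor_ext fun ξ η => by simp [opTensor_vecTensor, vecTensor_add_right]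

theorem opTensor_zero_left (b : K →L[ℂ] K) : opTensor (0 : H →L[ℂ] H) b = 0 := by
  simpa using opTensor_smul_left 0 (0 : H →L[ℂ] H) b

theorem opTensor_zero_right (a : H →L[ℂ] H) : opTensor a (0 : K →L[ℂ] K) = 0 := by
  simpa using opTensor_add_right a (0 : K →L[ℂ] K) 0

theorem opTensor_sum_right {ι : Type*} (s : Finset ι) (a : H →L[ℂ] H) (b : ι → K →L[ℂ] K) :
    opTensor a (∑ i ∈ s, b i) = ∑ i ∈ s, opTensor a (b i) := by
  induction s using Finset.cons_induction with
  | empty => simp [opTensor_zero_right]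
  | cons i s hi ih => simp [opTensor_add_right, ih]

theorem star_opTensor (a : H →L[ℂ] H) (b : K →L[ℂ] K) :
    star (opTensor a b) = opTensor (star a) (star b) := by
  refine hilbertTensor_ext fun ξ η => ext_inner_right ℂ fun x => ?_
  rw [ContinuousLinearMap.star_eq_adjoint, ContinuousLinearMap.adjoint_inner_left]
  suffices h : (innerSL ℂ (vecTensor ξ η)) ∘L opTensor a b =
      innerSL ℂ (opTensor (star a) (star b) (vecTensor ξ η)) from
    congrArg (fun f : HilbertTensor H K →L[ℂ] ℂ => f x) h
  refine hilbertTensor_ext fun ξ' η' => ?_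
  simp [opTensor_vecTensor, inner_vecTensor, ContinuousLinearMap.star_eq_adjoint,
    ContinuousLinearMap.adjoint_inner_left]

theorem norm_opTensor (a : H →L[ℂ] H) (b : K →L[ℂ] K) : ‖opTensor a b‖ = ‖a‖ * ‖b‖ := by
  refine le_antisymm ?_ ?_
  · refine ContinuousLinearMap.opNorm_le_bound _ (by positivity) fun x => ?_
    induction x using UniformSpace.Completion.induction_on with
    | hp => exact isClosed_le (by fun_prop) (by fun_prop)
    | ih x =>
      rw [opTensor, ContinuousLinearMap.completion_apply_coe, UniformSpace.Completion.norm_coe,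
        UniformSpace.Completion.norm_coe]
      exact (TensorProduct.mapL a b).le_of_opNorm_le (TensorProduct.norm_mapL_le a b) x
  · have h : ∀ ξ η, ‖a ξ‖ * ‖b η‖ ≤ ‖opTensor a b‖ * ‖ξ‖ * ‖η‖ := fun ξ η => by
      have := (opTensor a b).le_opNorm (vecTensor ξ η)
      rwa [opTensor_vecTensor, norm_vecTensor, norm_vecTensor, ← mul_assoc] at this
    rw [mul_comm, ← norm_norm b, ← norm_smul]
    refine ContinuousLinearMap.opNorm_le_bound _ (by positivity) fun ξ => ?_
    rw [smul_apply, norm_smul, norm_norm, mul_comm, ← norm_norm (a ξ),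
      ← norm_smul]
    refine ContinuousLinearMap.opNorm_le_bound _ (by positivity) fun η => ?_
    rw [smul_apply, norm_smul, norm_norm]
    exact h ξ η

/-! ### Faithfulness of the product trace -/

/-- A family of vectors that is separating for a von Neumann algebra is cyclic for its
commutant. -/
theorem topologicalClosure_span_commutant_eq_top {ι : Type*} {M : VonNeumannAlgebra H} {ξ : ι → H}
    (hξ : ∀ x ∈ M, (∀ i, x (ξ i) = 0) → x = 0) :
    (Submodule.span ℂ {v | ∃ c ∈ M.commutant, ∃ i, v = c (ξ i)}).topologicalClosure = ⊤ := by
  set V := (Submodule.span ℂ {v | ∃ c ∈ M.commutant, ∃ i, v = c (ξ i)}).topologicalClosure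
  have : CompleteSpace V := (Submodule.isClosed_topologicalClosure _).completeSpace_coe
  have hle : ∀ c ∈ M.commutant, ∀ i, c (ξ i) ∈ V := fun c hc i =>
    Submodule.le_topologicalClosure _ (Submodule.subset_span ⟨c, hc, i, rfl⟩)
  have hmem : V.starProjection ∈ M := by
    rw [VonNeumannAlgebra.IsStarProjection.mem_iff isStarProjection_starProjection]
    intro y hy
    rw [Submodule.range_starProjection, Module.End.mem_invtSubmodule]
    refine Submodule.topologicalClosure_minimal _ (Submodule.span_le.2 ?_)
      ((Submodule.isClosed_topologicalClosure _).preimage y.continuous)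
    rintro _ ⟨c, hc, i, rfl⟩
    exact hle (y * c) (mul_mem hy hc) i
  have h0 := hξ (1 - V.starProjection) (sub_mem (one_mem M) hmem) fun i => by
    exact sub_eq_zero.2 (V.starProjection_eq_self_iff.2 (hle 1 (one_mem _) i)).symm
  rw [sub_eq_zero] at h0
  refine eq_top_iff.2 fun v _ => ?_
  rw [← V.starProjection_eq_self_iff, ← h0, one_apply_eq_self]

/-- Elementary tensors as a continuous function of the left vector. -/
def vecTensorLeft (η : K) : H →L[ℂ] HilbertTensor H K :=
  LinearMap.mkContinuous
    { toFun := fun ξ => vecTensor ξ η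
      map_add' := fun ξ ξ' => vecTensor_add_left ξ ξ' η
      map_smul' := fun c ξ => vecTensor_smul_left c ξ η } ‖η‖ fun ξ => by
    rw [LinearMap.coe_mk, AddHom.coe_mk, norm_vecTensor, mul_comm]

/-- Elementary tensors as a continuous function of the right vector. -/
def vecTensorRight (ξ : H) : K →L[ℂ] HilbertTensor H K :=
  LinearMap.mkContinuous
    { toFun := fun η => vecTensor ξ η
      map_add' := fun η η' => vecTensor_add_right ξ η η'
      map_smul' := fun c η => vecTensor_smul_right c ξ η } ‖ξ‖ fun η => by
    rw [LinearMap.coe_mk, AddHom.coe_mk, norm_vecTensor]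

theorem opTensor_mem_vnTensor {M : VonNeumannAlgebra H} {B : VonNeumannAlgebra K}
    {a : H →L[ℂ] H} {b : K →L[ℂ] K} (ha : a ∈ M) (hb : b ∈ B) :
    opTensor a b ∈ vnTensor M B :=
  subset_generated _ ⟨a, ha, b, hb, rfl⟩

theorem vnTensor_mono {M N : VonNeumannAlgebra H} (h : N ≤ M) (B : VonNeumannAlgebra K) :
    vnTensor N B ≤ vnTensor M B := by
  refine generated_le ?_
  rintro _ ⟨a, ha, b, hb, rfl⟩
  exact opTensor_mem_vnTensor (h ha) hb

theorem opTensor_commute_of_mem_vnTensor {M : VonNeumannAlgebra H} {B : VonNeumannAlgebra K}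
    {c : H →L[ℂ] H} {d : K →L[ℂ] K} (hc : c ∈ M.commutant) (hd : d ∈ B.commutant)
    {x : HilbertTensor H K →L[ℂ] HilbertTensor H K} (hx : x ∈ vnTensor M B) :
    opTensor c d * x = x * opTensor c d := by
  refine ((StarSubalgebra.mem_centralizer_iff ℂ).1 hx (opTensor c d) ?_).1
  have h : ∀ a ∈ M, ∀ b ∈ B, opTensor a b * opTensor c d = opTensor c d * opTensor a b :=
    fun a ha b hb => by
      rw [opTensor_mul, opTensor_mul, VonNeumannAlgebra.mem_commutant_iff.1 hc a ha,
        VonNeumannAlgebra.mem_commutant_iff.1 hd b hb]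
  rw [SetLike.mem_coe, StarSubalgebra.mem_centralizer_iff]
  rintro _ ⟨a, ha, b, hb, rfl⟩
  rw [star_opTensor]
  exact ⟨h a ha b hb, h _ (star_mem ha) _ (star_mem hb)⟩

/-- Elementary tensors of separating families are separating for the tensor product: the
commutant of the tensor product contains the tensors of the commutants, for which these vectors
are cyclic. -/
theorem eq_zero_of_mem_vnTensor {ι κ : Type*} {M : VonNeumannAlgebra H} {B : VonNeumannAlgebra K}
    {ξ : ι → H} {η : κ → K} (hξ : ∀ x ∈ M, (∀ i, x (ξ i) = 0) → x = 0)
    (hη : ∀ x ∈ B, (∀ i, x (η i) = 0) → x = 0)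
    {x : HilbertTensor H K →L[ℂ] HilbertTensor H K} (hx : x ∈ vnTensor M B)
    (h : ∀ i j, x (vecTensor (ξ i) (η j)) = 0) : x = 0 := by
  have h1 : ∀ c ∈ M.commutant, ∀ d ∈ B.commutant, ∀ i j,
      x (vecTensor (c (ξ i)) (d (η j))) = 0 := fun c hc d hd i j => by
    rw [← opTensor_vecTensor, ← mul_apply_eq_comp,
      ← opTensor_commute_of_mem_vnTensor hc hd hx, mul_apply_eq_comp, h, map_zero]
  have h2 : ∀ v, ∀ d ∈ B.commutant, ∀ j, x (vecTensor v (d (η j))) = 0 := by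
    intro v d hd j
    have hle : (⊤ : Submodule ℂ H) ≤ (x ∘L vecTensorLeft (d (η j))).ker := by
      rw [← topologicalClosure_span_commutant_eq_top hξ]
      refine Submodule.topologicalClosure_minimal _ (Submodule.span_le.2 ?_)
        (ContinuousLinearMap.isClosed_ker _)
      rintro _ ⟨c, hc, i, rfl⟩
      exact h1 c hc d hd i j
    exact hle (Submodule.mem_top (x := v))
  refine hilbertTensor_ext fun v w => ?_
  have hle : (⊤ : Submodule ℂ K) ≤ (x ∘L vecTensorRight v).ker := by
    rw [← topologicalClosure_span_commutant_eq_top hη]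
    refine Submodule.topologicalClosure_minimal _ (Submodule.span_le.2 ?_)
      (ContinuousLinearMap.isClosed_ker _)
    rintro _ ⟨d, hd, j, rfl⟩
    exact h2 v d hd j
  exact hle (Submodule.mem_top (x := w))

namespace TracialState

variable {M : VonNeumannAlgebra H} (τ : TracialState M)

theorem summable_vectors : Summable fun i => ‖τ.vectors i‖ ^ 2 :=
  τ.normal'.choose_spec.1

theorem hasSum_vectors (x : M.toStarSubalgebra) :
    HasSum (fun i => inner ℂ (τ.vectors i) ((x : H →L[ℂ] H) (τ.vectors i))) (τ x) :=
  τ.normal'.choose_spec.2 x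

theorem hasSum_star_mul_self (x : M.toStarSubalgebra) :
    HasSum (fun i => ‖(x : H →L[ℂ] H) (τ.vectors i)‖ ^ 2) (τ (star x * x)).re := by
  have h := (τ.hasSum_vectors (star x * x)).mapL Complex.reCLM
  refine h.congr_fun fun i => ?_
  change _ = (inner ℂ (τ.vectors i)
    (star (x : H →L[ℂ] H) ((x : H →L[ℂ] H) (τ.vectors i)))).re
  rw [ContinuousLinearMap.star_eq_adjoint, ContinuousLinearMap.adjoint_inner_right,
    inner_self_eq_norm_sq_to_K]
  norm_cast

theorem eq_zero_of_apply_vectors (x : H →L[ℂ] H) (hx : x ∈ M) (h : ∀ i, x (τ.vectors i) = 0) :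
    x = 0 := by
  let x' : M.toStarSubalgebra := ⟨x, hx⟩
  refine congrArg Subtype.val (τ.faithful' x' ((τ.hasSum_vectors _).unique ?_))
  convert hasSum_zero with i
  change inner ℂ (τ.vectors i) (star x (x (τ.vectors i))) = 0
  rw [h, map_zero, inner_zero_right]

theorem map_star (x : M.toStarSubalgebra) : τ (star x) = star (τ x) := by
  refine (τ.hasSum_vectors _).unique ?_
  convert (τ.hasSum_vectors x).star with i
  change inner ℂ (τ.vectors i) (star (x : H →L[ℂ] H) (τ.vectors i)) = _
  rw [ContinuousLinearMap.star_eq_adjoint, ContinuousLinearMap.adjoint_inner_right]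
  exact (inner_conj_symm _ _).symm

theorem norm2_star (x : M.toStarSubalgebra) : τ.norm2 (star x) = τ.norm2 x := by
  rw [norm2, norm2, star_star, τ.tracial']

theorem norm2_sq (x : M.toStarSubalgebra) : τ.norm2 x ^ 2 = (τ (star x * x)).re :=
  Real.sq_sqrt ((τ.hasSum_star_mul_self x).nonneg fun _ => by positivity)

theorem ofReal_norm2_sq (x : M.toStarSubalgebra) : ((τ.norm2 x ^ 2 : ℝ) : ℂ) = τ (star x * x) := by
  have h := τ.map_star (star x * x)
  rw [star_mul, star_star] at h
  rw [norm2_sq]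
  exact Complex.conj_eq_iff_re.1 h.symm

theorem norm2_le_norm (x : M.toStarSubalgebra) : τ.norm2 x ≤ ‖(x : H →L[ℂ] H)‖ := by
  refine Real.sqrt_le_iff.2 ⟨norm_nonneg _, ?_⟩
  have h1 := τ.hasSum_star_mul_self 1
  have e : (τ (star 1 * 1)).re = 1 := by
    rw [star_one, mul_one, τ.map_one', Complex.one_re]
  rw [e] at h1
  have h2 := h1.mul_left (‖(x : H →L[ℂ] H)‖ ^ 2)
  rw [mul_one] at h2
  refine hasSum_le (fun i => ?_) (τ.hasSum_star_mul_self x) h2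
  rw [← mul_pow]
  gcongr
  exact (x : H →L[ℂ] H).le_opNorm _

end TracialState

section TensorTrace

variable {M : VonNeumannAlgebra H} {B : VonNeumannAlgebra K} (τ : TracialState M)
  (ν : TracialState B)

theorem summable_tensor_vectors :
    Summable fun p : ℕ × ℕ => ‖vecTensor (τ.vectors p.1) (ν.vectors p.2)‖ ^ 2 := by
  simp only [norm_vecTensor, mul_pow]
  exact τ.summable_vectors.mul_of_nonneg ν.summable_vectors (fun _ => by positivity)
    fun _ => by positivity

theorem summable_inner_of_summable_norm_sq {ι : Type*} {θ ζ : ι → H}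
    (hθ : Summable fun i => ‖θ i‖ ^ 2) (hζ : Summable fun i => ‖ζ i‖ ^ 2) :
    Summable fun i => (inner ℂ (θ i) (ζ i) : ℂ) :=
  lp.summable_inner (𝕜 := ℂ) (⟨θ, memℓp_two_iff.2 hθ⟩ : lp (fun _ : ι => H) 2)
    ⟨ζ, memℓp_two_iff.2 hζ⟩

theorem summable_tensorTrace (x : HilbertTensor H K →L[ℂ] HilbertTensor H K) :
    Summable fun p : ℕ × ℕ => (inner ℂ (vecTensor (τ.vectors p.1) (ν.vectors p.2))
      (x (vecTensor (τ.vectors p.1) (ν.vectors p.2))) : ℂ) :=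
  summable_inner_of_summable_norm_sq (summable_tensor_vectors τ ν)
    (summable_norm_sq_apply x (summable_tensor_vectors τ ν))

/-- The product trace as a linear functional on all bounded operators. -/
def tensorTraceLinear : (HilbertTensor H K →L[ℂ] HilbertTensor H K) →ₗ[ℂ] ℂ where
  toFun := tensorTrace τ ν
  map_add' x y := by
    rw [tensorTrace, tensorTrace, tensorTrace,
      ← (summable_tensorTrace τ ν x).tsum_add (summable_tensorTrace τ ν y)]
    exact tsum_congr fun p => by rw [add_apply, inner_add_right]
  map_smul' c x := by
    rw [tensorTrace, tensorTrace, RingHom.id_apply, smul_eq_mul, ← tsum_mul_left]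
    exact tsum_congr fun p => by rw [smul_apply, inner_smul_right]

theorem coe_tensorTraceLinear : ⇑(tensorTraceLinear τ ν) = tensorTrace τ ν := rfl

/-- The product trace is faithful on the von Neumann algebra tensor product. -/
theorem eq_zero_of_tensorTrace_mul_star {x : HilbertTensor H K →L[ℂ] HilbertTensor H K}
    (hx : x ∈ vnTensor M B) (h : tensorTrace τ ν (x * star x) = 0) : x = 0 := by
  have hterm : ∀ p : ℕ × ℕ, (inner ℂ (vecTensor (τ.vectors p.1) (ν.vectors p.2))
      ((x * star x) (vecTensor (τ.vectors p.1) (ν.vectors p.2))) : ℂ) =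
      ((‖star x (vecTensor (τ.vectors p.1) (ν.vectors p.2))‖ ^ 2 : ℝ) : ℂ) := fun p => by
    rw [mul_apply_eq_comp, ContinuousLinearMap.star_eq_adjoint,
      ← ContinuousLinearMap.adjoint_inner_left, inner_self_eq_norm_sq_to_K]
    norm_cast
  rw [tensorTrace, tsum_congr hterm, ← Complex.ofReal_tsum, Complex.ofReal_eq_zero] at h
  have hs := summable_norm_sq_apply (star x) (summable_tensor_vectors τ ν)
  have h0 := (hasSum_zero_iff_of_nonneg fun p => by positivity).1 (h ▸ hs.hasSum)
  rw [← star_eq_zero]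
  refine eq_zero_of_mem_vnTensor τ.eq_zero_of_apply_vectors ν.eq_zero_of_apply_vectors
    (star_mem hx) fun i j => ?_
  simpa using congrFun h0 (i, j)

end TensorTrace

/-! ### Conditional expectations -/

theorem IsCondExp.sum {ι : Type*} {φ : (H →L[ℂ] H) →ₗ[ℂ] ℂ} {N : VonNeumannAlgebra H}
    {s : Finset ι} {x y : ι → H →L[ℂ] H} (h : ∀ i ∈ s, IsCondExp φ N (x i) (y i)) :
    IsCondExp φ N (∑ i ∈ s, x i) (∑ i ∈ s, y i) := by
  refine ⟨sum_mem fun i hi => (h i hi).1, fun z hz => ?_⟩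
  rw [Finset.sum_mul, Finset.sum_mul, map_sum, map_sum]
  exact Finset.sum_congr rfl fun i hi => (h i hi).2 z hz

section TensorCondExp

variable {M : VonNeumannAlgebra H} {B : VonNeumannAlgebra K} (τ : TracialState M)
  (ν : TracialState B)

/-- Faithfulness of the product trace makes the conditional expectation unique. -/
theorem condExp_eq {N : VonNeumannAlgebra (HilbertTensor H K)} (hN : N ≤ vnTensor M B)
    {x y : HilbertTensor H K →L[ℂ] HilbertTensor H K} (h : IsCondExp (tensorTrace τ ν) N x y) :
    condExp (tensorTrace τ ν) N x = y := by
  have hex : ∃ y, IsCondExp (tensorTrace τ ν) N x y := ⟨y, h⟩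
  rw [condExp, dif_pos hex]
  have h' := hex.choose_spec
  set y' := hex.choose
  have hmem : y' - y ∈ N := sub_mem h'.1 h.1
  rw [← sub_eq_zero]
  refine eq_zero_of_tensorTrace_mul_star τ ν (hN hmem) ?_
  rw [sub_mul, ← coe_tensorTraceLinear, map_sub, coe_tensorTraceLinear, sub_eq_zero,
    h'.2 _ (star_mem hmem), h.2 _ (star_mem hmem)]

/-- If `a'` is the conditional expectation of `a` onto `N`, then `a' ⊗ b` is that of `a ⊗ b`
onto the tensor product of `N` and `B`: by normality of the trace it suffices to test against
elementary tensors. -/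
theorem isCondExp_opTensor {N : VonNeumannAlgebra H} (hN : N ≤ M)
    {a a' : M.toStarSubalgebra} (ha' : (a' : H →L[ℂ] H) ∈ N)
    (h : ∀ c : M.toStarSubalgebra, (c : H →L[ℂ] H) ∈ N → τ (a' * c) = τ (a * c))
    (b : B.toStarSubalgebra) :
    IsCondExp (tensorTrace τ ν) (vnTensor N B) (opTensor (a : H →L[ℂ] H) (b : K →L[ℂ] K))
      (opTensor (a' : H →L[ℂ] H) (b : K →L[ℂ] K)) := by
  refine ⟨opTensor_mem_vnTensor ha' b.2, fun z hz => ?_⟩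
  set w := opTensor (a' : H →L[ℂ] H) (b : K →L[ℂ] K) -
    opTensor (a : H →L[ℂ] H) (b : K →L[ℂ] K) with hw
  have key : ∀ x, tensorTrace τ ν (w * x) =
      ∑' p : ℕ × ℕ, inner ℂ (star w (vecTensor (τ.vectors p.1) (ν.vectors p.2)))
        (x (vecTensor (τ.vectors p.1) (ν.vectors p.2))) := fun x => by
    rw [tensorTrace]
    refine tsum_congr fun p => ?_
    rw [ContinuousLinearMap.star_eq_adjoint, ContinuousLinearMap.adjoint_inner_left,
      mul_apply_eq_comp]
  have hdiff : ∀ x, tensorTrace τ ν (w * x) =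
      tensorTrace τ ν (opTensor (a' : H →L[ℂ] H) (b : K →L[ℂ] K) * x) -
        tensorTrace τ ν (opTensor (a : H →L[ℂ] H) (b : K →L[ℂ] K) * x) := fun x => by
    rw [hw, sub_mul, ← coe_tensorTraceLinear, map_sub]
  rw [← sub_eq_zero, ← hdiff, key]
  refine tsum_inner_eq_zero_of_mem_generated ?_ ?_ ?_
    (summable_norm_sq_apply _ (summable_tensor_vectors τ ν)) (summable_tensor_vectors τ ν) ?_ hz
  · rintro _ ⟨c, hc, d, hd, rfl⟩ _ ⟨c', hc', d', hd', rfl⟩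
    exact ⟨c * c', mul_mem hc hc', d * d', mul_mem hd hd', opTensor_mul _ _ _ _⟩
  · rintro _ ⟨c, hc, d, hd, rfl⟩
    exact ⟨star c, star_mem hc, star d, star_mem hd, star_opTensor _ _⟩
  · exact ⟨1, one_mem _, 1, one_mem _, opTensor_one.symm⟩
  · rintro _ ⟨c, hc, d, hd, rfl⟩
    rw [← key, hdiff, opTensor_mul, opTensor_mul]
    let c' : M.toStarSubalgebra := ⟨c, hN hc⟩
    let d' : B.toStarSubalgebra := ⟨d, hd⟩
    have e1 := tensorTrace_opTensor τ ν (a' * c') (b * d')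
    have e2 := tensorTrace_opTensor τ ν (a * c') (b * d')
    rw [h c' hc, ← e2] at e1
    exact sub_eq_zero.2 e1

end TensorCondExp

/-! ### Order independent sequences -/

theorem filtration_le {A : ℕ → VonNeumannAlgebra H} {M : VonNeumannAlgebra H} (hA : ∀ n, A n ≤ M)
    (n : ℕ) : filtration A n ≤ M :=
  generated_le (Set.iUnion₂_subset fun k _ => hA k)

theorem le_filtration (A : ℕ → VonNeumannAlgebra H) {k n : ℕ} (h : k ≤ n) :
    A k ≤ filtration A n := fun _ hx =>
  subset_generated _ (Set.mem_iUnion₂.2 ⟨k, h, hx⟩)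

theorem le_generated_of_lt (A : ℕ → VonNeumannAlgebra H) {k n : ℕ} (h : k < n) :
    A k ≤ generated (⋃ j < n, (A j : Set (H →L[ℂ] H))) := fun _ hx =>
  subset_generated _ (Set.mem_iUnion₂.2 ⟨k, h, hx⟩)

theorem filtration_le_generated_of_lt (A : ℕ → VonNeumannAlgebra H) {k n : ℕ} (h : k < n) :
    filtration A k ≤ generated (⋃ j < n, (A j : Set (H →L[ℂ] H))) :=
  generated_le (Set.iUnion₂_subset fun _ hj => le_generated_of_lt A (hj.trans_lt h))

/-! ### Sums of positive operators -/

theorem star_finset_sum {ι : Type*} (s : Finset ι) (x : ι → H →L[ℂ] H) :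
    star (∑ i ∈ s, x i) = ∑ i ∈ s, star (x i) :=
  star_sum s x

theorem star_sum_mul_sum {ι : Type*} (s : Finset ι) (x : ι → H →L[ℂ] H) :
    star (∑ i ∈ s, x i) * ∑ i ∈ s, x i = ∑ i ∈ s, ∑ j ∈ s, star (x i) * x j := by
  rw [star_sum, Finset.sum_mul_sum]

theorem norm_sum_star_mul_self_mono {ι : Type*} {s t : Finset ι} (h : s ⊆ t)
    (x : ι → H →L[ℂ] H) :
    ‖∑ i ∈ s, star (x i) * x i‖ ≤ ‖∑ i ∈ t, star (x i) * x i‖ :=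
  CStarAlgebra.norm_le_norm_of_nonneg_of_le
    (Finset.sum_nonneg fun i _ => star_mul_self_nonneg (x i))
    (Finset.sum_le_sum_of_subset_of_nonneg h fun i _ _ => star_mul_self_nonneg (x i))

theorem norm_sum_star_mul_self_mul_le {ι : Type*} (s : Finset ι) {r : ℝ} {c : ι → H →L[ℂ] H}
    (hc : ∀ i ∈ s, ‖c i‖ ≤ r) (x : ι → H →L[ℂ] H) :
    ‖∑ i ∈ s, star (c i * x i) * (c i * x i)‖ ≤ r ^ 2 * ‖∑ i ∈ s, star (x i) * x i‖ := by
  have h : ∑ i ∈ s, star (c i * x i) * (c i * x i) ≤ r ^ 2 • ∑ i ∈ s, star (x i) * x i := by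
    rw [Finset.smul_sum]
    refine Finset.sum_le_sum fun i hi => ?_
    have h1 := CStarAlgebra.star_left_conjugate_le_norm_smul (a := x i) (b := star (c i) * c i)
    rw [CStarRing.norm_star_mul_self, ← sq] at h1
    calc star (c i * x i) * (c i * x i) = star (x i) * (star (c i) * c i) * x i := by
          simp only [star_mul, mul_assoc]
      _ ≤ ‖c i‖ ^ 2 • (star (x i) * x i) := h1
      _ ≤ r ^ 2 • (star (x i) * x i) := by
          refine smul_le_smul_of_nonneg_right ?_ (star_mul_self_nonneg _)
          gcongr
          exact hc i hi
  refine (CStarAlgebra.norm_le_norm_of_nonneg_of_le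
    (Finset.sum_nonneg fun i _ => star_mul_self_nonneg _) h).trans_eq ?_
  rw [norm_smul, Real.norm_of_nonneg (sq_nonneg r)]

theorem le_norm_sum_star_mul_self_smul {ι : Type*} (s : Finset ι) {r : ℝ} (hr : 0 ≤ r) {t : ι → ℝ}
    (ht : ∀ i ∈ s, r ≤ t i) (x : ι → H →L[ℂ] H) :
    r ^ 2 * ‖∑ i ∈ s, star (x i) * x i‖ ≤
      ‖∑ i ∈ s, star ((t i : ℂ) • x i) * ((t i : ℂ) • x i)‖ := by
  have h : r ^ 2 • ∑ i ∈ s, star (x i) * x i ≤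
      ∑ i ∈ s, star ((t i : ℂ) • x i) * ((t i : ℂ) • x i) := by
    rw [Finset.smul_sum]
    refine Finset.sum_le_sum fun i hi => ?_
    have e : star ((t i : ℂ) • x i) * ((t i : ℂ) • x i) = t i ^ 2 • (star (x i) * x i) := by
      rw [Complex.coe_smul, star_smul, star_trivial, smul_mul_smul_comm, ← sq]
    rw [e]
    refine smul_le_smul_of_nonneg_right ?_ (star_mul_self_nonneg _)
    gcongr
    exact ht i hi
  have h0 : 0 ≤ r ^ 2 • ∑ i ∈ s, star (x i) * x i :=
    smul_nonneg (sq_nonneg r) (Finset.sum_nonneg fun i _ => star_mul_self_nonneg _)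
  refine le_of_eq_of_le ?_ (CStarAlgebra.norm_le_norm_of_nonneg_of_le h0 h)
  rw [norm_smul, Real.norm_of_nonneg (sq_nonneg r)]

section Column

variable {M : VonNeumannAlgebra H} {τ : TracialState M} {A : ℕ → VonNeumannAlgebra H}
  {a : ℕ → M.toStarSubalgebra}

/-- The conditional expectation of `|a k|²` onto the algebra generated by `A 0, …, A n`, for
`n ≤ k`. -/
def condExpSq (τ : TracialState M) (a : ℕ → M.toStarSubalgebra) (n k : ℕ) : M.toStarSubalgebra :=
  if k = n then star (a k) * a k else τ (star (a k) * a k) • 1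

theorem condExpSq_mem (haA : ∀ n, (a n : H →L[ℂ] H) ∈ A n) (n k : ℕ) :
    (condExpSq τ a n k : H →L[ℂ] H) ∈ filtration A n := by
  rw [condExpSq]
  split_ifs with h
  · subst h
    have := le_filtration A (le_refl k) (haA k)
    exact mul_mem (star_mem this) this
  · exact (filtration A n).toStarSubalgebra.smul_mem (one_mem _) _

/-- Since `a j` and `a k` are centred, order independence annihilates the off-diagonal terms,
after moving the factor of larger index to the front by traciality. -/
theorem trace_star_mul_mul (hind : OrderIndependent τ A) (haA : ∀ n, (a n : H →L[ℂ] H) ∈ A n)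
    (ha0 : ∀ n, τ (a n) = 0) {n j k : ℕ} (hj : n ≤ j) (hk : n ≤ k) (c : M.toStarSubalgebra)
    (hc : (c : H →L[ℂ] H) ∈ filtration A n) :
    τ ((if j = k then condExpSq τ a n k else 0) * c) = τ (star (a j) * a k * c) := by
  split_ifs with hjk
  · subst hjk
    rw [condExpSq]
    split_ifs with hn
    · rfl
    · rw [hind j (star (a j) * a j) c (mul_mem (star_mem (haA j)) (haA j))
        (filtration_le_generated_of_lt A (by omega) hc), smul_mul_assoc, one_mul, map_smul,
        smul_eq_mul]
  · rw [zero_mul, map_zero, mul_assoc]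
    rcases lt_or_gt_of_ne hjk with h | h
    · rw [τ.tracial', mul_assoc, hind k (a k) (c * star (a j)) (haA k), ha0, zero_mul]
      exact mul_mem (filtration_le_generated_of_lt A (by omega) hc)
        (star_mem (le_generated_of_lt A h (haA j)))
    · rw [hind j (star (a j)) (a k * c) (star_mem (haA j)), τ.map_star, ha0, star_zero, zero_mul]
      exact mul_mem (le_generated_of_lt A h (haA k))
        (filtration_le_generated_of_lt A (by omega) hc)

theorem trace_mul (hind : OrderIndependent τ A) (haA : ∀ n, (a n : H →L[ℂ] H) ∈ A n)
    (ha0 : ∀ n, τ (a n) = 0) (n k : ℕ) (c : M.toStarSubalgebra)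
    (hc : (c : H →L[ℂ] H) ∈ filtration A n) :
    τ ((if k < n + 1 then a k else 0) * c) = τ (a k * c) := by
  split_ifs with h
  · rfl
  · rw [hind k (a k) c (haA k) (filtration_le_generated_of_lt A (by omega) hc), ha0, zero_mul,
      zero_mul, map_zero]

variable {B : VonNeumannAlgebra K} (ν : TracialState B)

theorem condExpPrev_sum (hA : ∀ n, A n ≤ M) (hind : OrderIndependent τ A)
    (haA : ∀ n, (a n : H →L[ℂ] H) ∈ A n) (ha0 : ∀ n, τ (a n) = 0) (m : ℕ)
    (b : ℕ → B.toStarSubalgebra) (n : ℕ) :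
    condExpPrev (tensorTrace τ ν) (fun n => vnTensor (filtration A n) B) n
        (∑ k ∈ Finset.range m, opTensor (a k : H →L[ℂ] H) (b k : K →L[ℂ] K)) =
      ∑ k ∈ Finset.range m with ¬ n ≤ k, opTensor (a k : H →L[ℂ] H) (b k : K →L[ℂ] K) := by
  cases n with
  | zero => simp [condExpPrev]
  | succ n =>
    rw [condExpPrev]
    refine condExp_eq τ ν (vnTensor_mono (filtration_le hA n) B) ?_
    have e : ∑ k ∈ Finset.range m with ¬ n + 1 ≤ k,
        opTensor (a k : H →L[ℂ] H) (b k : K →L[ℂ] K) = ∑ k ∈ Finset.range m,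
          opTensor ((if k < n + 1 then a k else 0 : M.toStarSubalgebra) : H →L[ℂ] H)
            (b k : K →L[ℂ] K) := by
      rw [Finset.sum_filter]
      refine Finset.sum_congr rfl fun k _ => ?_
      by_cases h : k < n + 1
      · rw [if_pos (not_le.2 h), if_pos h]
      · rw [if_neg (not_not.2 (not_lt.1 h)), if_neg h]
        exact (opTensor_zero_left _).symm
    rw [e, ← coe_tensorTraceLinear]
    refine IsCondExp.sum fun k _ => isCondExp_opTensor τ ν (filtration_le hA n) ?_
      (trace_mul hind haA ha0 n k) (b k)
    split_ifs with h
    · exact le_filtration A (Nat.lt_succ_iff.1 h) (haA k)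
    · exact zero_mem _

/-- The conditional square of the tail of the martingale `∑ a k ⊗ b k` is diagonal. -/
theorem condExp_star_mul_tail (hA : ∀ n, A n ≤ M) (hind : OrderIndependent τ A)
    (haA : ∀ n, (a n : H →L[ℂ] H) ∈ A n) (ha0 : ∀ n, τ (a n) = 0) (m : ℕ)
    (b : ℕ → B.toStarSubalgebra) (n : ℕ) :
    condExp (tensorTrace τ ν) (vnTensor (filtration A n) B)
        (star (∑ k ∈ Finset.range m with n ≤ k, opTensor (a k : H →L[ℂ] H) (b k : K →L[ℂ] K)) *
          ∑ k ∈ Finset.range m with n ≤ k, opTensor (a k : H →L[ℂ] H) (b k : K →L[ℂ] K)) =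
      ∑ k ∈ Finset.range m with n ≤ k, opTensor (condExpSq τ a n k : H →L[ℂ] H)
        (star (b k : K →L[ℂ] K) * (b k : K →L[ℂ] K)) := by
  refine condExp_eq τ ν (vnTensor_mono (filtration_le hA n) B) ?_
  set s := (Finset.range m).filter fun k => n ≤ k
  have e : ∑ k ∈ s, opTensor (condExpSq τ a n k : H →L[ℂ] H)
      (star (b k : K →L[ℂ] K) * (b k : K →L[ℂ] K)) = ∑ j ∈ s, ∑ k ∈ s,
        opTensor ((if j = k then condExpSq τ a n k else 0 : M.toStarSubalgebra) : H →L[ℂ] H)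
          ((star (b j) * b k : B.toStarSubalgebra) : K →L[ℂ] K) := by
    refine Finset.sum_congr rfl fun j hj => ?_
    rw [Finset.sum_eq_single_of_mem j hj, if_pos rfl]
    · rfl
    · intro k _ hk
      rw [if_neg hk.symm]
      exact opTensor_zero_left _
  have e' : star (∑ k ∈ s, opTensor (a k : H →L[ℂ] H) (b k : K →L[ℂ] K)) *
      (∑ k ∈ s, opTensor (a k : H →L[ℂ] H) (b k : K →L[ℂ] K)) = ∑ j ∈ s, ∑ k ∈ s,
        opTensor ((star (a j) * a k : M.toStarSubalgebra) : H →L[ℂ] H)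
          ((star (b j) * b k : B.toStarSubalgebra) : K →L[ℂ] K) := by
    refine (star_sum_mul_sum _ _).trans
      (Finset.sum_congr rfl fun j _ => Finset.sum_congr rfl fun k _ => ?_)
    rw [star_opTensor, opTensor_mul]
    rfl
  rw [e, e', ← coe_tensorTraceLinear]
  refine IsCondExp.sum fun j hj => IsCondExp.sum fun k hk =>
    isCondExp_opTensor τ ν (filtration_le hA n) ?_ (trace_star_mul_mul hind haA ha0
      (Finset.mem_filter.1 hj).2 (Finset.mem_filter.1 hk).2) _
  split_ifs with h
  · exact condExpSq_mem haA n k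
  · exact zero_mem _

theorem bmoC_sum (hA : ∀ n, A n ≤ M) (hind : OrderIndependent τ A)
    (haA : ∀ n, (a n : H →L[ℂ] H) ∈ A n) (ha0 : ∀ n, τ (a n) = 0) (m : ℕ)
    (b : ℕ → B.toStarSubalgebra) :
    bmoC (tensorTrace τ ν) (fun n => vnTensor (filtration A n) B)
        (∑ k ∈ Finset.range m, opTensor (a k : H →L[ℂ] H) (b k : K →L[ℂ] K)) =
      (⨆ n : ℕ, ‖∑ k ∈ Finset.range m with n ≤ k, opTensor (condExpSq τ a n k : H →L[ℂ] H)
        (star (b k : K →L[ℂ] K) * (b k : K →L[ℂ] K))‖ₑ) ^ (1 / 2 : ℝ) := by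
  rw [bmoC]
  congr 1
  refine iSup_congr fun n => ?_
  rw [condExpPrev_sum ν hA hind haA ha0, ← Finset.sum_filter_add_sum_filter_not
    (Finset.range m) (fun k => n ≤ k), add_sub_cancel_right,
    condExp_star_mul_tail ν hA hind haA ha0]

/-! ### Norm estimates -/

/-- A square root of `condExpSq τ a n k`. -/
def condExpSqRoot (τ : TracialState M) (a : ℕ → M.toStarSubalgebra) (n k : ℕ) : H →L[ℂ] H :=
  if k = n then (a k : H →L[ℂ] H) else (τ.norm2 (a k) : ℂ) • 1

theorem coe_condExpSq (n k : ℕ) :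
    (condExpSq τ a n k : H →L[ℂ] H) = star (condExpSqRoot τ a n k) * condExpSqRoot τ a n k := by
  rw [condExpSq, condExpSqRoot]
  split_ifs
  · rfl
  · rw [← τ.ofReal_norm2_sq, star_smul, star_one, smul_mul_smul_comm, one_mul,
      RCLike.star_def, Complex.conj_ofReal, ← sq, ← Complex.ofReal_pow]
    rfl

theorem norm_condExpSqRoot_le {β : ℝ} (hβ : ∀ n, ‖(a n : H →L[ℂ] H)‖ ≤ β) (n k : ℕ) :
    ‖condExpSqRoot τ a n k‖ ≤ β := by
  rw [condExpSqRoot]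
  split_ifs
  · exact hβ k
  · have h0 : 0 ≤ τ.norm2 (a k) := Real.sqrt_nonneg _
    rw [norm_smul, Complex.norm_real, Real.norm_of_nonneg h0]
    exact (mul_le_of_le_one_right h0 ContinuousLinearMap.norm_id_le).trans
      ((τ.norm2_le_norm _).trans (hβ k))

theorem opTensor_star_mul_self (a : H →L[ℂ] H) (b : K →L[ℂ] K) :
    opTensor (star a * a) (star b * b) = star (opTensor a b) * opTensor a b := by
  rw [star_opTensor, opTensor_mul]

theorem norm_sum_one_opTensor (s : Finset ℕ) (b : ℕ → K →L[ℂ] K) :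
    ‖∑ k ∈ s, star (opTensor (1 : H →L[ℂ] H) (b k)) * opTensor 1 (b k)‖ =
      ‖(1 : H →L[ℂ] H)‖ * ‖∑ k ∈ s, star (b k) * b k‖ := by
  rw [← norm_opTensor, opTensor_sum_right]
  refine congrArg _ (Finset.sum_congr rfl fun k _ => ?_)
  rw [← opTensor_star_mul_self, star_one, one_mul]

theorem norm_sum_condExpSq_le {β : ℝ} (hβ : ∀ n, ‖(a n : H →L[ℂ] H)‖ ≤ β) (m n : ℕ)
    (b : ℕ → K →L[ℂ] K) :
    ‖∑ k ∈ Finset.range m with n ≤ k,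
        opTensor (condExpSq τ a n k : H →L[ℂ] H) (star (b k) * b k)‖ ≤
      β ^ 2 * ‖∑ k ∈ Finset.range m, star (b k) * b k‖ := by
  have hβ0 : 0 ≤ β := (norm_nonneg _).trans (hβ 0)
  have e : ∀ k, opTensor (condExpSq τ a n k : H →L[ℂ] H) (star (b k) * b k) =
      star (opTensor (condExpSqRoot τ a n k) (1 : K →L[ℂ] K) * opTensor 1 (b k)) *
        (opTensor (condExpSqRoot τ a n k) (1 : K →L[ℂ] K) * opTensor 1 (b k)) := fun k => by
    rw [coe_condExpSq, opTensor_star_mul_self, opTensor_mul, mul_one, one_mul]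
  rw [Finset.sum_congr rfl fun k _ => e k]
  refine (norm_sum_star_mul_self_mul_le _ (r := β) (fun k _ => ?_) _).trans ?_
  · rw [norm_opTensor]
    exact (mul_le_of_le_one_right (norm_nonneg _) ContinuousLinearMap.norm_id_le).trans
      (norm_condExpSqRoot_le hβ n k)
  · rw [norm_sum_one_opTensor]
    gcongr
    exact (mul_le_of_le_one_left (norm_nonneg _) ContinuousLinearMap.norm_id_le).trans
      (norm_sum_star_mul_self_mono (Finset.filter_subset _ _) b)

/-- The lower estimate comes from the first index of the filtration. The term `k = 0` is not
averaged, so it is estimated separately; this costs the factor `2`. -/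
theorem norm_sum_le_norm_sum_condExpSq {α : ℝ} (hα : 0 ≤ α) (ha : ∀ n, α ≤ τ.norm2 (a n)) (m : ℕ)
    (b : ℕ → K →L[ℂ] K) :
    α ^ 2 * ‖∑ k ∈ Finset.range m, star (b k) * b k‖ ≤
      2 * ‖∑ k ∈ Finset.range m with 0 ≤ k,
        opTensor (condExpSq τ a 0 k : H →L[ℂ] H) (star (b k) * b k)‖ := by
  rw [Finset.filter_true_of_mem fun _ _ => Nat.zero_le _]
  rcases Nat.eq_zero_or_pos m with rfl | hm
  · rw [Finset.sum_range_zero, norm_zero, mul_zero]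
    positivity
  have h0m : 0 ∈ Finset.range m := Finset.mem_range.2 hm
  have hone : (1 : ℝ) ≤ ‖(1 : H →L[ℂ] H)‖ := by
    have h := τ.norm2_le_norm 1
    rwa [TracialState.norm2, star_one, mul_one, τ.map_one', Complex.one_re, Real.sqrt_one] at h
  have e : ∀ k, opTensor (condExpSq τ a 0 k : H →L[ℂ] H) (star (b k) * b k) =
      star (opTensor (condExpSqRoot τ a 0 k) (b k)) * opTensor (condExpSqRoot τ a 0 k) (b k) :=
    fun k => by rw [coe_condExpSq, opTensor_star_mul_self]
  rw [Finset.sum_congr rfl fun k _ => e k]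
  have hhead := norm_sum_star_mul_self_mono (Finset.singleton_subset_iff.2 h0m)
    fun k => opTensor (condExpSqRoot τ a 0 k) (b k)
  rw [Finset.sum_singleton, ← opTensor_star_mul_self, norm_opTensor, CStarRing.norm_star_mul_self,
    condExpSqRoot, if_pos rfl, ← sq] at hhead
  have hhead' : α ^ 2 * ‖star (b 0) * b 0‖ ≤ ‖(a 0 : H →L[ℂ] H)‖ ^ 2 * ‖star (b 0) * b 0‖ := by
    gcongr
    exact (ha 0).trans (τ.norm2_le_norm _)
  have htail := norm_sum_star_mul_self_mono (Finset.erase_subset 0 (Finset.range m))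
    fun k => opTensor (condExpSqRoot τ a 0 k) (b k)
  have hroot : ∀ k ∈ (Finset.range m).erase 0, opTensor (condExpSqRoot τ a 0 k) (b k) =
      (τ.norm2 (a k) : ℂ) • opTensor 1 (b k) := fun k hk => by
    rw [condExpSqRoot, if_neg (Finset.ne_of_mem_erase hk), opTensor_smul_left]
  rw [Finset.sum_congr rfl fun k hk => by rw [hroot k hk]] at htail
  have htail' := (le_norm_sum_star_mul_self_smul ((Finset.range m).erase 0) hα
    (fun k _ => ha k) fun k => opTensor (1 : H →L[ℂ] H) (b k)).trans htail
  rw [norm_sum_one_opTensor] at htail'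
  have hT : α ^ 2 * ‖∑ k ∈ (Finset.range m).erase 0, star (b k) * b k‖ ≤
      α ^ 2 * (‖(1 : H →L[ℂ] H)‖ * ‖∑ k ∈ (Finset.range m).erase 0, star (b k) * b k‖) := by
    gcongr
    exact le_mul_of_one_le_left (norm_nonneg _) hone
  have htri := mul_le_mul_of_nonneg_left (norm_add_le (star (b 0) * b 0)
    (∑ k ∈ (Finset.range m).erase 0, star (b k) * b k)) (sq_nonneg α)
  rw [Finset.add_sum_erase _ (fun k => star (b k) * b k) h0m, mul_add] at htri
  linarith

theorem squareNormC_sq (m : ℕ) (b : ℕ → K →L[ℂ] K) :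
    squareNormC m b ^ 2 = ‖∑ n ∈ Finset.range m, star (b n) * b n‖ := by
  have h0 : 0 ≤ ∑ n ∈ Finset.range m, star (b n) * b n :=
    Finset.sum_nonneg fun n _ => star_mul_self_nonneg _
  have hs : IsSelfAdjoint (CFC.sqrt (∑ n ∈ Finset.range m, star (b n) * b n)) :=
    .of_nonneg (CFC.sqrt_nonneg _)
  rw [squareNormC, sq, ← CStarRing.norm_star_mul_self, hs.star_eq, CFC.sqrt_mul_sqrt_self _ h0]

theorem ofReal_eq_rpow_half {r : ℝ} (hr : 0 ≤ r) :
    ENNReal.ofReal r = ENNReal.ofReal (r ^ 2) ^ (1 / 2 : ℝ) := by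
  rw [ENNReal.ofReal_rpow_of_nonneg (sq_nonneg r) (by norm_num), ← Real.sqrt_eq_rpow,
    Real.sqrt_sq hr]

/-- The column half of the equivalence of norms. -/
theorem bmoC_equiv_squareNormC {α β C : ℝ} (hα : 0 < α) (hCα : 2 / α ≤ C) (hCβ : |β| ≤ C)
    (hA : ∀ n, A n ≤ M) (hind : OrderIndependent τ A) (haA : ∀ n, (a n : H →L[ℂ] H) ∈ A n)
    (ha0 : ∀ n, τ (a n) = 0) (ha : ∀ n, α ≤ τ.norm2 (a n))
    (hβ : ∀ n, ‖(a n : H →L[ℂ] H)‖ ≤ β) (m : ℕ) (b : ℕ → B.toStarSubalgebra) :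
    ENNReal.ofReal (C⁻¹ * squareNormC m fun n => (b n : K →L[ℂ] K)) ≤
        bmoC (tensorTrace τ ν) (fun n => vnTensor (filtration A n) B)
          (∑ k ∈ Finset.range m, opTensor (a k : H →L[ℂ] H) (b k : K →L[ℂ] K)) ∧
      bmoC (tensorTrace τ ν) (fun n => vnTensor (filtration A n) B)
          (∑ k ∈ Finset.range m, opTensor (a k : H →L[ℂ] H) (b k : K →L[ℂ] K)) ≤
        ENNReal.ofReal (C * squareNormC m fun n => (b n : K →L[ℂ] K)) := by
  have hC : 0 < C := (by positivity : 0 < 2 / α).trans_le hCα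
  have hs : 0 ≤ squareNormC m fun n => (b n : K →L[ℂ] K) := norm_nonneg _
  rw [bmoC_sum ν hA hind haA ha0, ofReal_eq_rpow_half (mul_nonneg (inv_nonneg.2 hC.le) hs),
    ofReal_eq_rpow_half (mul_nonneg hC.le hs), mul_pow, mul_pow, squareNormC_sq]
  constructor
  · refine ENNReal.rpow_le_rpow (le_iSup_of_le 0 ?_) (by norm_num)
    rw [← ofReal_norm]
    refine ENNReal.ofReal_le_ofReal ?_
    have h := norm_sum_le_norm_sum_condExpSq hα.le ha m fun n => (b n : K →L[ℂ] K)
    have hCα' : C⁻¹ ≤ α / 2 := by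
      rw [← inv_div]
      exact inv_anti₀ (by positivity) hCα
    have hCsq : C⁻¹ ^ 2 ≤ α ^ 2 / 2 := by
      have h1 : C⁻¹ ^ 2 ≤ (α / 2) ^ 2 := by gcongr
      nlinarith [sq_nonneg α]
    have h2 := mul_le_mul_of_nonneg_right hCsq
      (norm_nonneg (∑ k ∈ Finset.range m, star (b k : K →L[ℂ] K) * (b k : K →L[ℂ] K)))
    linarith
  · refine ENNReal.rpow_le_rpow (iSup_le fun n => ?_) (by norm_num)
    rw [← ofReal_norm]
    refine ENNReal.ofReal_le_ofReal
      ((norm_sum_condExpSq_le hβ m n fun n => (b n : K →L[ℂ] K)).trans ?_)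
    have hβC : β ^ 2 ≤ C ^ 2 := by
      rw [← sq_abs β]
      gcongr
    gcongr

end Column

end NCBMO

end

theorem corollary5p4 (α β : ℝ) (hα : 0 < α) :
    ∃ C : ℝ, 0 < C ∧
      ∀ (H : Type*) [NormedAddCommGroup H] [InnerProductSpace ℂ H] [CompleteSpace H]
        (M : VonNeumannAlgebra H) (τ : NCBMO.TracialState M)
        (A : ℕ → VonNeumannAlgebra H) (a : ℕ → M.toStarSubalgebra),
        (∀ n, A n ≤ M) → NCBMO.OrderIndependent τ A → (∀ n, (a n : H →L[ℂ] H) ∈ A n) →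
        (∀ n, τ (a n) = 0) →
        IsGLB (Set.range fun n => τ.norm2 (a n)) α →
        IsLUB (Set.range fun n => ‖(a n : H →L[ℂ] H)‖) β →
      ∀ (K : Type*) [NormedAddCommGroup K] [InnerProductSpace ℂ K] [CompleteSpace K]
        (B : VonNeumannAlgebra K) (ν : NCBMO.TracialState B)
        (m : ℕ) (b : ℕ → B.toStarSubalgebra),
        ENNReal.ofReal (C⁻¹ * NCBMO.squareNorm m fun n => (b n : K →L[ℂ] K)) ≤
            NCBMO.bmo (NCBMO.tensorTrace τ ν)
              (fun n => NCBMO.vnTensor (NCBMO.filtration A n) B)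
              (∑ n ∈ Finset.range m, NCBMO.opTensor (a n : H →L[ℂ] H) (b n : K →L[ℂ] K)) ∧
          NCBMO.bmo (NCBMO.tensorTrace τ ν)
              (fun n => NCBMO.vnTensor (NCBMO.filtration A n) B)
              (∑ n ∈ Finset.range m, NCBMO.opTensor (a n : H →L[ℂ] H) (b n : K →L[ℂ] K)) ≤
            ENNReal.ofReal (C * NCBMO.squareNorm m fun n => (b n : K →L[ℂ] K)) := by
  have hC : 0 < |β| + 2 / α := by positivity
  refine ⟨|β| + 2 / α, hC, ?_⟩
  intro H _ _ _ M τ A a hA hind haA ha0 hglb hlub K _ _ _ B ν m b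
  have hα' : ∀ n, α ≤ τ.norm2 (a n) := fun n => hglb.1 ⟨n, rfl⟩
  have hβ' : ∀ n, ‖(a n : H →L[ℂ] H)‖ ≤ β := fun n => hlub.1 ⟨n, rfl⟩
  have hCα : 2 / α ≤ |β| + 2 / α := le_add_of_nonneg_left (abs_nonneg β)
  have hCβ : |β| ≤ |β| + 2 / α := le_add_of_nonneg_right (by positivity)
  have hcol := NCBMO.bmoC_equiv_squareNormC ν hα hCα hCβ hA hind haA ha0 hα' hβ' m b
  have hrow := NCBMO.bmoC_equiv_squareNormC (a := fun n => star (a n)) ν hα hCα hCβ hA hind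
    (fun n => star_mem (haA n)) (fun n => by rw [τ.map_star, ha0, star_zero])
    (fun n => (hα' n).trans_eq (τ.norm2_star _).symm)
    (fun n => (norm_star (a n : H →L[ℂ] H)).trans_le (hβ' n)) m (fun n => star (b n))
  have hstar : star (∑ n ∈ Finset.range m,
      NCBMO.opTensor (a n : H →L[ℂ] H) (b n : K →L[ℂ] K)) = ∑ n ∈ Finset.range m,
        NCBMO.opTensor ((star (a n) : M.toStarSubalgebra) : H →L[ℂ] H)
          ((star (b n) : B.toStarSubalgebra) : K →L[ℂ] K) := by
    exact (NCBMO.star_finset_sum _ _).trans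
      (Finset.sum_congr rfl fun n _ => NCBMO.star_opTensor _ _)
  have hR : NCBMO.squareNormR m (fun n => (b n : K →L[ℂ] K)) =
      NCBMO.squareNormC m fun n => ((star (b n) : B.toStarSubalgebra) : K →L[ℂ] K) := by
    rw [NCBMO.squareNormR, NCBMO.squareNormC]
    congr 2
    exact Finset.sum_congr rfl fun n _ =>
      congrArg (· * star (b n : K →L[ℂ] K)) (star_star (b n : K →L[ℂ] K)).symm
  rw [NCBMO.bmo, NCBMO.squareNorm, hR, hstar, mul_max_of_nonneg _ _ hC.le,
    mul_max_of_nonneg _ _ (inv_nonneg.2 hC.le), ENNReal.ofReal_max, ENNReal.ofReal_max]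
  exact ⟨max_le_max hcol.1 hrow.1, max_le_max hcol.2 hrow.2⟩
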